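/- Let $R$ be a commutative artinian ring and let $A$ be an artin $R$-algebra, i.e. an $R$-algebra that is finitely generated as an $R$-module. Modules are left $A$-modules, not necessarily finitely generated. A module is Gorenstein-projective if it is isomorphic to $\operatorname{Ker}(P^0\to P^1)$ for some acyclic complex $P^\bullet$ of projective $A$-modules, indexed by $\mathbb Z$, such that $\operatorname{Hom}_A(P^\bullet,Q)$ is acyclic for every projective $A$-module $Q$. A proper Gorenstein-projective resolution of a module $M$ is an exact sequence $\cdots\to G^{-1}\to G^0\to M\to 0$ with every $G^{-i}$ Gorenstein-projective that remains exact under $\operatorname{Hom}_A(G,-)$ for every Gorenstein-projective module $G$. Over an artin algebra every module $M$ has such a resolution $G^\bullet\to M$, and it is unique up to homotopy; put $\operatorname{Ext}^n_{\mathrm{GP}}(M,N)=H^n(\operatorname{Hom}_A(G^\bullet,N))$ and $$\mathrm{GP.dim}\,M=\sup\{n\ge 0 \mid \operatorname{Ext}^n_{\mathrm{GP}}(M,N)\neq 0 \text{ for some } A\text{-module } N\}\in\{0,1,2,\dots\}\cup\{\infty\},$$ where $\sup\emptyset=0$. Theorem. Let $M$ be an $A$-module and let $n\ge 0$ be an integer.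 The following are equivalent: 1. $\mathrm{GP.dim}\,M\le n$; 2. there exists an exact sequence $0\to G^{-n}\to\cdots\to G^{-1}\to G^0\to M\to 0$ with each $G^{-i}$ Gorenstein-projective; 3. for each exact sequence $0\to K\to G^{1-n}\to\cdots\to G^{-1}\to G^0\to M\to 0$ with each $G^{-i}$ Gorenstein-projective, the module $K$ is Gorenstein-projective (for $n=0$ the sequence reads $0\to K\to M\to 0$). -/

import Mathlib

universe w u

noncomputable section

namespace GorensteinProj

open CategoryTheory CategoryTheory.Limits

variable {A : Type u} [Ring A]

/-- The complex of abelian groups `Hom_A(K, Q)`, with `Hom_A(K i, Q)` placed in degree `i` and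
differentials given by precomposition with the differentials of `K` (so the direction of the
differentials is reversed). -/
def homInto {ι : Type} {c : ComplexShape ι} (K : HomologicalComplex (ModuleCat.{u} A) c)
    (Q : ModuleCat.{u} A) : HomologicalComplex AddCommGrpCat.{u} c.symm :=
  ((preadditiveYoneda.obj Q).mapHomologicalComplex c.symm).obj K.op

/-- The complex of abelian groups `Hom_A(G, K)`, with `Hom_A(G, K i)` placed in degree `i` and
differentials given by postcomposition with the differentials of `K`. -/
def homFrom {ι : Type} {c : ComplexShape ι} (G : ModuleCat.{u} A)
    (K : HomologicalComplex (ModuleCat.{u} A) c) : HomologicalComplex AddCommGrpCat.{u} c :=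
  ((preadditiveCoyoneda.obj (Opposite.op G)).mapHomologicalComplex c).obj K

/-- A totally acyclic complex of projective modules: an acyclic complex `P` of (not necessarily
finitely generated) projective modules such that `Hom_A(P, Q)` is acyclic for every projective
module `Q`. -/
structure IsTotallyAcyclic (P : CochainComplex (ModuleCat.{u} A) ℤ) : Prop where
  projective : ∀ i : ℤ, Module.Projective A (P.X i)
  acyclic : P.Acyclic
  hom_acyclic : ∀ Q : ModuleCat.{u} A, Module.Projective A Q → (homInto P Q).Acyclic

/-- A (large) Gorenstein-projective module: a module isomorphic to the zeroth cocycle module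
`Ker (d : P^0 ⟶ P^1)` of a totally acyclic complex. -/
def IsGorensteinProjective (M : ModuleCat.{u} A) : Prop :=
  ∃ P : CochainComplex (ModuleCat.{u} A) ℤ, IsTotallyAcyclic P ∧ Nonempty (M ≅ P.cycles 0)

/-- An exact sequence `⋯ ⟶ X 2 ⟶ X 1 ⟶ X 0 ⟶ M ⟶ 0` of modules. -/
structure LeftResolution (M : ModuleCat.{u} A) where
  complex : ChainComplex (ModuleCat.{u} A) ℕ
  ε : complex.X 0 ⟶ M
  w : complex.d 1 0 ≫ ε = 0
  acyclic : (complex.augment ε w).Acyclic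

/-- The complex `⋯ ⟶ X 2 ⟶ X 1 ⟶ X 0 ⟶ M ⟶ 0`, with `M` in degree `0`. -/
def LeftResolution.augmented {M : ModuleCat.{u} A} (E : LeftResolution M) :
    ChainComplex (ModuleCat.{u} A) ℕ :=
  E.complex.augment E.ε E.w

/-- A proper Gorenstein-projective resolution `⋯ ⟶ G 1 ⟶ G 0 ⟶ M ⟶ 0`: all `G i` are
Gorenstein-projective and the whole sequence (including `M`) stays acyclic under `Hom_A(G, -)` for
every Gorenstein-projective `G`. -/
structure LeftResolution.IsProperGP {M : ModuleCat.{u} A} (E : LeftResolution M) : Prop where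
  gorensteinProjective : ∀ i : ℕ, IsGorensteinProjective (E.complex.X i)
  hom_acyclic : ∀ G : ModuleCat.{u} A, IsGorensteinProjective G → (homFrom G E.augmented).Acyclic

/-- The `n`-th GP-extension group `Ext_GP^n(M, N) = H^n(Hom_A(G, N))` computed from a proper
Gorenstein-projective resolution `G ⟶ M`. (By the comparison theorem it does not depend on the
resolution, up to isomorphism.) -/
def gpExt {M : ModuleCat.{u} A} (E : LeftResolution M) (N : ModuleCat.{u} A) (n : ℕ) :
    AddCommGrpCat.{u} :=
  (homInto E.complex N).homology n

open Classical in
/-- The Gorenstein-projective dimension `sup {n ≥ 0 | Ext_GP^n(M, -) ≠ 0}` of `M`, as an extended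
natural number, where `Ext_GP` is computed from a proper Gorenstein-projective resolution of `M`.
Over an artin algebra every module has such a resolution, so that the second branch, for a module
without one, does not occur there. -/
def gpDim (M : ModuleCat.{u} A) : ℕ∞ :=
  if h : ∃ E : LeftResolution M, E.IsProperGP then
    sSup {k : ℕ∞ | ∃ n : ℕ, k = n ∧ ∃ N : ModuleCat.{u} A, ¬ IsZero (gpExt h.choose N n)}
  else ⊤

end GorensteinProj

end

/-!
Resolutions are handled one short exact sequence at a time. The Gorenstein-projective objects form
a resolving class, so whether the `n`-th syzygy of `M` is Gorenstein-projective does not depend on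
the Gorenstein-projective resolution used to compute it; this links the two conditions on exact
sequences.

For a proper resolution, `Ext_GP^(n+1)(M, -) = 0` says exactly that the inclusion of the `(n+1)`-st
syzygy splits: applied to that syzygy itself, it extends the identity. By properness the inclusion
splits as soon as the `n`-th syzygy is Gorenstein-projective, and the converse holds because
Gorenstein-projective objects are closed under direct summands.

A module with a finite Gorenstein-projective resolution has a proper one: by the construction of
Auslander and Buchweitz it is a quotient of a Gorenstein-projective module by a module of finite
projective dimension, and `Ext^1` from a Gorenstein-projective module into the latter vanishes.
-/

universe v u₁

noncomputable section

namespace GorensteinProj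

open CategoryTheory Limits Abelian Opposite ZeroObject

section Extension

variable {C : Type u₁} [Category.{v} C] [Abelian C]

/-- `Y` is an extension of `Z` by `X`: there is a short exact sequence `0 ⟶ X ⟶ Y ⟶ Z ⟶ 0`. Only
its existence is recorded, since the closure properties below never refer to the maps. -/
def IsExtension (X Y Z : C) : Prop :=
  ∃ (f : X ⟶ Y) (g : Y ⟶ Z) (w : f ≫ g = 0), (ShortComplex.mk f g w).ShortExact

namespace IsExtension

variable {X Y Z : C}

lemma of_shortExact {S : ShortComplex C} (hS : S.ShortExact) :
    IsExtension S.X₁ S.X₂ S.X₃ :=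
  ⟨S.f, S.g, S.zero, hS⟩

lemma of_iso (h : IsExtension X Y Z) {X' Y' Z' : C} (eX : X ≅ X') (eY : Y ≅ Y') (eZ : Z ≅ Z') :
    IsExtension X' Y' Z' := by
  obtain ⟨f, g, w, hS⟩ := h
  exact .of_shortExact (ShortComplex.shortExact_of_iso
    (ShortComplex.isoMk
      (S₂ := .mk (eX.inv ≫ f ≫ eY.hom) (eY.inv ≫ g ≫ eZ.hom) (by simp [reassoc_of% w]))
      eX eY eZ) hS)

lemma op (h : IsExtension X Y Z) : IsExtension (op Z) (op Y) (op X) := by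
  obtain ⟨f, g, w, hS⟩ := h
  exact .of_shortExact hS.op

lemma unop {X Y Z : Cᵒᵖ} (h : IsExtension X Y Z) :
    IsExtension (unop Z) (unop Y) (unop X) := by
  obtain ⟨f, g, w, hS⟩ := h
  exact .of_shortExact hS.unop

lemma biprod (X Y : C) : IsExtension X (X ⊞ Y) Y :=
  .of_shortExact (ShortComplex.Splitting.ofHasBinaryBiproduct X Y).shortExact

lemma kernel {X Y : C} (f : X ⟶ Y) [Epi f] : IsExtension (kernel f) X Y :=
  .of_shortExact (S := .mk (kernel.ι f) f (kernel.condition f))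
    { exact := ShortComplex.exact_of_f_is_kernel _ (kernelIsKernel f) }

end IsExtension

section Pushout

variable {S : ShortComplex C} {W L : C}

lemma shortExact_of_isPushout_f (hS : S.ShortExact) {i : S.X₁ ⟶ W} {j : S.X₂ ⟶ L} {f' : W ⟶ L}
    (sq : IsPushout S.f i j f') :
    ∃ (g' : L ⟶ S.X₃) (w : f' ≫ g' = 0), (ShortComplex.mk f' g' w).ShortExact := by
  have := hS.mono_f
  have := hS.epi_g
  let g' : L ⟶ S.X₃ := sq.desc S.g 0 (by simp)
  have hg' : j ≫ g' = S.g := sq.inl_desc ..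
  have w : f' ≫ g' = 0 := sq.inr_desc ..
  have : Epi g' := epi_of_epi_fac hg'
  have : Mono f' := (MorphismProperty.monomorphisms C).of_isPushout sq.flip ‹Mono S.f›
  refine ⟨g', w, { exact := ShortComplex.exact_of_g_is_cokernel _ ?_ }⟩
  refine CokernelCofork.IsColimit.ofπ' g' w fun {T} k hk ↦
    ⟨hS.exact.desc (j ≫ k) (by rw [sq.w_assoc, hk, comp_zero]), sq.hom_ext ?_ ?_⟩
  · rw [reassoc_of% hg', hS.exact.g_desc]
  · rw [reassoc_of% w, zero_comp, hk]

lemma shortExact_of_isPushout_g (hS : S.ShortExact) {i : S.X₂ ⟶ W} {j : S.X₃ ⟶ L} {g' : W ⟶ L}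
    [Mono i] (sq : IsPushout S.g i j g') :
    ∃ w : (S.f ≫ i) ≫ g' = 0, (ShortComplex.mk (S.f ≫ i) g' w).ShortExact := by
  have := hS.mono_f
  have := hS.epi_g
  have w : (S.f ≫ i) ≫ g' = 0 := by simp [← sq.w]
  have : Epi g' := (MorphismProperty.epimorphisms C).of_isPushout sq.flip ‹Epi S.g›
  have : Mono (S.f ≫ i) := mono_comp ..
  refine ⟨w, { exact := ShortComplex.exact_of_g_is_cokernel _ ?_ }⟩
  refine CokernelCofork.IsColimit.ofπ' g' w fun {T} k hk ↦ ⟨sq.desc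
    (hS.exact.desc (i ≫ k) (by rw [← Category.assoc, hk])) k (hS.exact.g_desc ..), sq.inr_desc ..⟩

end Pushout

lemma nonempty_iso_biprod_of_isSplitMono {X Y Z : C} {f : X ⟶ Y} {g : Y ⟶ Z} {w : f ≫ g = 0}
    (hS : (ShortComplex.mk f g w).ShortExact) [IsSplitMono f] : Nonempty (Y ≅ X ⊞ Z) :=
  have := hS.epi_g
  ⟨(ShortComplex.Splitting.ofExactOfRetraction _ hS.exact (retraction f)
    (IsSplitMono.id f) this).isoBinaryBiproduct⟩

namespace IsExtension

variable {K G P M W : C}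

lemma exists_pushout (h : IsExtension K G M) (h' : IsExtension K W P) :
    ∃ L, IsExtension G L P ∧ IsExtension W L M := by
  obtain ⟨f, g, w, hS⟩ := h
  obtain ⟨f', g', w', hS'⟩ := h'
  have sq := IsPushout.of_hasPushout f f'
  obtain ⟨_, _, hM⟩ := shortExact_of_isPushout_f hS sq
  obtain ⟨_, _, hP⟩ := shortExact_of_isPushout_f hS' sq.flip
  exact ⟨_, .of_shortExact hP, .of_shortExact hM⟩

lemma exists_cokernel_comp (h : IsExtension K G M) (h' : IsExtension G P W) :
    ∃ L, IsExtension K P L ∧ IsExtension M L W := by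
  obtain ⟨f, g, w, hS⟩ := h
  obtain ⟨i, p, w', hS'⟩ := h'
  have := hS'.mono_f
  have sq := IsPushout.of_hasPushout g i
  obtain ⟨_, hL⟩ := shortExact_of_isPushout_g hS sq
  obtain ⟨_, _, hM⟩ := shortExact_of_isPushout_f hS' sq.flip
  exact ⟨_, .of_shortExact hL, .of_shortExact hM⟩

lemma exists_pullback (h : IsExtension K G M) (h' : IsExtension P W M) :
    ∃ L, IsExtension P L G ∧ IsExtension K L W := by
  obtain ⟨L, hL, hL'⟩ := h.op.exists_pushout h'.op
  exact ⟨L.unop, hL.unop, hL'.unop⟩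

lemma exists_kernel_comp (h : IsExtension K G M) (h' : IsExtension P W G) :
    ∃ L, IsExtension L W M ∧ IsExtension P L K := by
  obtain ⟨L, hL, hL'⟩ := h.op.exists_cokernel_comp h'.op
  exact ⟨L.unop, hL.unop, hL'.unop⟩

lemma biprod_left (W : C) (h : IsExtension K G M) : IsExtension (W ⊞ K) (W ⊞ G) M := by
  obtain ⟨f, g, w, hS⟩ := h
  have := hS.mono_f
  have := hS.epi_g
  have w' : biprod.map (𝟙 W) f ≫ biprod.desc 0 g = 0 := by ext <;> simp [w]
  have : Epi (biprod.desc (0 : W ⟶ M) g) := epi_of_epi_fac (biprod.inr_desc _ _)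
  refine .of_shortExact (S := .mk _ _ w') { exact := ShortComplex.exact_of_g_is_cokernel _ ?_ }
  refine CokernelCofork.IsColimit.ofπ' _ w' fun {T} k hk ↦
    ⟨hS.exact.desc (biprod.inr ≫ k) ?_, ?_⟩
  · simpa using biprod.inr ≫= hk
  · have hinl : biprod.inl ≫ k = 0 := by simpa using biprod.inl ≫= hk
    ext
    · simp [hinl]
    · simpa using hS.exact.g_desc ..

end IsExtension

end Extension

section Resolving

variable {C : Type u₁} [Category.{v} C] [Abelian C]

/-- A resolving class of objects: one that contains all projective objects and is closed under
extensions and under kernels of epimorphisms. -/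
structure IsResolving (G : ObjectProperty C) : Prop where
  of_projective (P : C) [Projective P] : G P
  middle {X Y Z : C} : IsExtension X Y Z → G X → G Z → G Y
  left {X Y Z : C} : IsExtension X Y Z → G Y → G Z → G X

lemma IsResolving.of_iso {G : ObjectProperty C} (hG : IsResolving G) {X Y : C} (e : X ≅ Y)
    (hX : G X) : G Y :=
  hG.middle ((IsExtension.biprod X (0 : C)).of_iso (.refl X)
    ((isoBiprodZero (isZero_zero C)).symm ≪≫ e) (.refl 0)) hX (hG.of_projective 0)

/-- The objects `M` with a resolution `0 ⟶ Gₙ ⟶ ⋯ ⟶ G₀ ⟶ M ⟶ 0` of length `n` by objects of the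
class `G`, described one kernel at a time. -/
def resolutionLE (G : ObjectProperty C) : ℕ → ObjectProperty C
  | 0 => G
  | n + 1 => fun M ↦ ∃ K X, resolutionLE G n K ∧ G X ∧ IsExtension K X M

/-- The class `G` has a projective cogenerator: each of its objects is the kernel of an epimorphism
from a projective object onto an object of `G`. -/
def HasProjectiveCogenerator (G : ObjectProperty C) : Prop :=
  ∀ X, G X → ∃ P Z, Projective P ∧ G Z ∧ IsExtension X P Z

namespace IsResolving

variable {G : ObjectProperty C} (hG : IsResolving G) {X Y Z : C}

include hG

lemma resolutionLE_of_iso {n : ℕ} (e : X ≅ Y) (hX : resolutionLE G n X) : resolutionLE G n Y := by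
  cases n with
  | zero => exact hG.of_iso e hX
  | succ n =>
    obtain ⟨K, H, hK, hH, h⟩ := hX
    exact ⟨K, H, hK, hH, h.of_iso (.refl K) (.refl H) e⟩

lemma resolutionLE_left {n : ℕ} (h : IsExtension X Y Z) (hY : resolutionLE G n Y) (hZ : G Z) :
    resolutionLE G n X := by
  cases n with
  | zero => exact hG.left h hY hZ
  | succ n =>
    obtain ⟨K, H, hK, hH, hY⟩ := hY
    obtain ⟨L, hL, hKL⟩ := h.exists_kernel_comp hY
    exact ⟨K, L, hK, hG.left hL hH hZ, hKL⟩

lemma resolutionLE_middle [EnoughProjectives C] {n : ℕ} (h : IsExtension X Y Z)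
    (hX : resolutionLE G n X) (hZ : G Z) : resolutionLE G n Y := by
  induction n generalizing X Y Z with
  | zero => exact hG.middle h hX hZ
  | succ n ih =>
    obtain ⟨K, H, hK, hH, hX⟩ := hX
    have hP := hG.of_projective (Projective.over Y)
    have hY := IsExtension.kernel (Projective.π Y)
    obtain ⟨Ω, hΩ, hΩX⟩ := h.exists_kernel_comp hY
    obtain ⟨L, hL, hL'⟩ := hΩX.exists_pullback hX
    have hLn : resolutionLE G n L := ih hL hK (hG.left hΩ hP hZ)
    exact ⟨_, _, hG.resolutionLE_left hL' hLn hH, hP, hY⟩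

lemma resolutionLE_succ_iff [EnoughProjectives C] {n : ℕ} (h : IsExtension X Y Z) (hY : G Y) :
    resolutionLE G (n + 1) Z ↔ resolutionLE G n X := by
  refine ⟨?_, fun hX ↦ ⟨X, Y, hX, hY, h⟩⟩
  rintro ⟨K, H, hK, hH, hZ⟩
  obtain ⟨L, hL, hL'⟩ := hZ.exists_pullback h
  exact hG.resolutionLE_left hL (hG.resolutionLE_middle hL' hK hY) hH

lemma resolutionLE_iff_of_chain [EnoughProjectives C] (n : ℕ) (Z H : ℕ → C)
    (h : ∀ i < n, IsExtension (Z (i + 1)) (H i) (Z i)) (hH : ∀ i < n, G (H i)) :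
    resolutionLE G n (Z 0) ↔ G (Z n) := by
  induction n generalizing Z H with
  | zero => rfl
  | succ n ih =>
    rw [hG.resolutionLE_succ_iff (h 0 n.succ_pos) (hH 0 n.succ_pos)]
    exact ih (fun i ↦ Z (i + 1)) (fun i ↦ H (i + 1)) (fun i hi ↦ h (i + 1) (by lia))
      fun i hi ↦ hH (i + 1) (by lia)

end IsResolving

end Resolving

section Approximation

variable {C : Type u₁} [Category.{v} C] [Abelian C] {G : ObjectProperty C} {M : C} {n : ℕ}

lemma IsExtension.hasProjectiveDimensionLE_succ {X Y Z : C} (h : IsExtension X Y Z) {n : ℕ}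
    (hX : HasProjectiveDimensionLE X n) (hY : Projective Y) :
    HasProjectiveDimensionLE Z (n + 1) := by
  obtain ⟨f, g, w, hS⟩ := h
  exact (hS.hasProjectiveDimensionLT_X₃_iff n hY).2 hX

lemma exists_hull_of_resolutionLE (hG : IsResolving G) (hcog : HasProjectiveCogenerator G)
    (hM : resolutionLE G n M) :
    ∃ W X, HasProjectiveDimensionLE W n ∧ G X ∧ IsExtension M W X := by
  induction n generalizing M with
  | zero =>
    obtain ⟨P, Z, hP, hZ, h⟩ := hcog M hM
    exact ⟨P, Z, (projective_iff_hasProjectiveDimensionLE_zero P).1 hP, hZ, h⟩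
  | succ n ih =>
    obtain ⟨K, H, hK, hH, hM⟩ := hM
    obtain ⟨W, X, hW, hX, hKW⟩ := ih hK
    obtain ⟨L, hHL, hWL⟩ := hM.exists_pushout hKW
    obtain ⟨P, Z, hP, hZ, hLP⟩ := hcog L (hG.middle hHL hH hX)
    obtain ⟨W', hWP, hMW⟩ := hWL.exists_cokernel_comp hLP
    exact ⟨W', Z, hWP.hasProjectiveDimensionLE_succ hW hP, hZ, hMW⟩

lemma exists_approximation_of_resolutionLE_succ (hG : IsResolving G)
    (hcog : HasProjectiveCogenerator G) (hM : resolutionLE G (n + 1) M) :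
    ∃ W X, HasProjectiveDimensionLE W n ∧ G X ∧ IsExtension W X M := by
  obtain ⟨K, H, hK, hH, hM⟩ := hM
  obtain ⟨W, X, hW, hX, hKW⟩ := exists_hull_of_resolutionLE hG hcog hK
  obtain ⟨L, hHL, hWL⟩ := hM.exists_pushout hKW
  exact ⟨W, L, hW, hG.middle hHL hH hX, hWL⟩

end Approximation

section ExtOrthogonal

variable {C : Type u₁} [Category.{v} C] [Abelian C] [HasExt.{w} C]

namespace IsExtension

variable {X Y Z T : C} {n : ℕ}

lemma subsingleton_ext_middle (h : IsExtension X Y Z) (hX : Subsingleton (Ext X T n))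
    (hZ : Subsingleton (Ext Z T n)) : Subsingleton (Ext Y T n) := by
  obtain ⟨f, g, w, hS⟩ := h
  refine subsingleton_of_forall_eq 0 fun e ↦ ?_
  obtain ⟨e', rfl⟩ := Ext.contravariant_sequence_exact₂ hS _ e (Subsingleton.elim _ _)
  rw [Subsingleton.elim e' 0, Ext.comp_zero]

lemma subsingleton_ext_left (h : IsExtension X Y Z) (hY : Subsingleton (Ext Y T n))
    (hZ : Subsingleton (Ext Z T (n + 1))) : Subsingleton (Ext X T n) := by
  obtain ⟨f, g, w, hS⟩ := h
  refine subsingleton_of_forall_eq 0 fun e ↦ ?_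
  obtain ⟨e', rfl⟩ :=
    Ext.contravariant_sequence_exact₁ hS _ e (add_comm 1 n) (Subsingleton.elim _ _)
  rw [Subsingleton.elim e' 0, Ext.comp_zero]

lemma subsingleton_ext_right (h : IsExtension X Y Z) (hX : Subsingleton (Ext X T n))
    (hY : Subsingleton (Ext Y T (n + 1))) : Subsingleton (Ext Z T (n + 1)) := by
  obtain ⟨f, g, w, hS⟩ := h
  refine subsingleton_of_forall_eq 0 fun e ↦ ?_
  obtain ⟨e', rfl⟩ :=
    Ext.contravariant_sequence_exact₃ hS _ e (Subsingleton.elim _ _) (add_comm 1 n)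
  rw [Subsingleton.elim e' 0, Ext.comp_zero]

lemma subsingleton_ext_target_right (h : IsExtension X Y Z) (hY : Subsingleton (Ext T Y n))
    (hX : Subsingleton (Ext T X (n + 1))) : Subsingleton (Ext T Z n) := by
  obtain ⟨f, g, w, hS⟩ := h
  refine subsingleton_of_forall_eq 0 fun e ↦ ?_
  obtain ⟨e', rfl⟩ := Ext.covariant_sequence_exact₃ _ hS e rfl (Subsingleton.elim _ _)
  rw [Subsingleton.elim e' 0, Ext.zero_comp]

end IsExtension

section ShortExact

variable {S : ShortComplex C} (hS : S.ShortExact) {T : C}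

include hS

lemma exists_extension_of_subsingleton_ext [Subsingleton (Ext S.X₃ T 1)] (φ : S.X₁ ⟶ T) :
    ∃ ψ : S.X₂ ⟶ T, S.f ≫ ψ = φ := by
  obtain ⟨e, he⟩ := Ext.contravariant_sequence_exact₁ hS _ (Ext.mk₀ φ) (add_zero 1)
    (Subsingleton.elim _ _)
  obtain ⟨ψ, rfl⟩ := (Ext.mk₀_bijective _ _).2 e
  rw [Ext.mk₀_comp_mk₀] at he
  exact ⟨ψ, (Ext.mk₀_bijective _ _).1 he⟩

lemma exists_lift_of_subsingleton_ext [Subsingleton (Ext T S.X₁ 1)] (φ : T ⟶ S.X₃) :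
    ∃ ψ : T ⟶ S.X₂, ψ ≫ S.g = φ := by
  obtain ⟨e, he⟩ := Ext.covariant_sequence_exact₃ _ hS (Ext.mk₀ φ) (zero_add 1)
    (Subsingleton.elim _ _)
  obtain ⟨ψ, rfl⟩ := (Ext.mk₀_bijective _ _).2 e
  rw [Ext.mk₀_comp_mk₀] at he
  exact ⟨ψ, (Ext.mk₀_bijective _ _).1 he⟩

lemma subsingleton_ext_one_of_forall_exists_extension [Subsingleton (Ext S.X₂ T 1)]
    (h : ∀ φ : S.X₁ ⟶ T, ∃ ψ : S.X₂ ⟶ T, S.f ≫ ψ = φ) : Subsingleton (Ext S.X₃ T 1) := by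
  refine subsingleton_of_forall_eq 0 fun e ↦ ?_
  obtain ⟨e', rfl⟩ :=
    Ext.contravariant_sequence_exact₃ hS _ e (Subsingleton.elim _ _) (add_zero 1)
  obtain ⟨φ, rfl⟩ := (Ext.mk₀_bijective _ _).2 e'
  obtain ⟨ψ, rfl⟩ := h φ
  rw [← Ext.mk₀_comp_mk₀, ← Ext.comp_assoc_of_second_deg_zero, hS.extClass_comp, Ext.zero_comp]

end ShortExact

lemma IsExtension.nonempty_iso_biprod {X Y Z : C} (h : IsExtension X Y Z)
    [Subsingleton (Ext Z X 1)] : Nonempty (Y ≅ X ⊞ Z) := by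
  obtain ⟨f, g, w, hS⟩ := h
  obtain ⟨r, hr⟩ := exists_extension_of_subsingleton_ext hS (𝟙 X)
  have : IsSplitMono f := .mk' ⟨r, hr⟩
  exact nonempty_iso_biprod_of_isSplitMono hS

/-- The objects `X` with `Ext^(n+1)(X, Y) = 0` for all `n ≥ 0` and all `Y` in the class `Q`. -/
def extLeftOrthogonal (Q : ObjectProperty C) : ObjectProperty C :=
  fun X ↦ ∀ ⦃Y : C⦄, Q Y → ∀ n : ℕ, Subsingleton (Ext X Y (n + 1))

lemma isResolving_extLeftOrthogonal (Q : ObjectProperty C) :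
    IsResolving (extLeftOrthogonal Q) where
  of_projective P _ _ _ n := Ext.subsingleton_of_projective P _ n
  middle h hX hZ _ hY n := h.subsingleton_ext_middle (hX hY n) (hZ hY n)
  left h hY hZ _ hT n := h.subsingleton_ext_left (hY hT n) (hZ hT (n + 1))

lemma extLeftOrthogonal_of_retract {Q : ObjectProperty C} {X Y : C} (r : Retract X Y)
    (hY : extLeftOrthogonal Q Y) : extLeftOrthogonal Q X := by
  refine fun T hT n ↦ subsingleton_of_forall_eq 0 fun e ↦ ?_
  have := hY hT n
  rw [← e.mk₀_id_comp, ← r.retract, ← Ext.mk₀_comp_mk₀, Ext.comp_assoc_of_second_deg_zero,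
    Subsingleton.elim ((Ext.mk₀ r.r).comp e (zero_add _)) 0, Ext.comp_zero]

lemma subsingleton_ext_of_hasProjectiveDimensionLE [EnoughProjectives C] {G : C}
    (hG : extLeftOrthogonal (isProjective C) G) (d : ℕ) (T : C) [HasProjectiveDimensionLE T d]
    (n : ℕ) : Subsingleton (Ext G T (n + 1)) := by
  induction d generalizing T n with
  | zero => exact hG ((projective_iff_hasProjectiveDimensionLE_zero T).2 ‹_›) n
  | succ d ih =>
    let S := ShortComplex.mk _ (Projective.π T) (kernel.condition _)
    have hS : S.ShortExact := { exact := ShortComplex.exact_of_f_is_kernel _ (kernelIsKernel _) }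
    have := (hS.hasProjectiveDimensionLT_X₃_iff d (Projective.projective_over T)).1 ‹_›
    exact (IsExtension.of_shortExact hS).subsingleton_ext_target_right
      (hG (Projective.projective_over T) n) (ih _ (n + 1))

lemma extLeftOrthogonal_of_int_chain {Q : ObjectProperty C} (Z : ℤ → C)
    (h : ∀ i, ∃ P, Projective P ∧ IsExtension (Z i) P (Z (i + 1)))
    (hZ : ∀ i Y, Q Y → Subsingleton (Ext (Z i) Y 1)) (i : ℤ) : extLeftOrthogonal Q (Z i) := by
  intro Y hY n
  induction n generalizing i with
  | zero => exact hZ i Y hY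
  | succ n ih =>
    obtain ⟨P, _, hP⟩ := h (i - 1)
    rw [sub_add_cancel] at hP
    exact hP.subsingleton_ext_right (ih (i - 1)) (Ext.subsingleton_of_projective P Y (n + 1))

end ExtOrthogonal

section GorensteinProjective

variable (C : Type u₁) [Category.{v} C] [Abelian C] [HasExt.{w} C]

/-- The Gorenstein-projective objects of an abelian category with enough projectives, described
coinductively: the largest class of objects without positive extensions by projective objects that
has a projective cogenerator. Iterating the latter property yields the right half of a totally
acyclic complex. -/
def gorensteinProjective : ObjectProperty C :=
  fun X ↦ ∃ S : ObjectProperty C,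
    S X ∧ S ≤ extLeftOrthogonal (isProjective C) ∧ HasProjectiveCogenerator S

lemma gorensteinProjective_le :
    gorensteinProjective C ≤ extLeftOrthogonal (isProjective C) :=
  fun X ⟨_, hX, hS, _⟩ ↦ hS X hX

lemma hasProjectiveCogenerator_gorensteinProjective :
    HasProjectiveCogenerator (gorensteinProjective C) := by
  rintro X ⟨S, hX, hS, hcog⟩
  obtain ⟨P, Z, hP, hZ, h⟩ := hcog X hX
  exact ⟨P, Z, hP, ⟨S, hZ, hS, hcog⟩, h⟩

variable {C} {X Y Z : C}

lemma gorensteinProjective_of_projective (P : C) [Projective P] : gorensteinProjective C P := by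
  refine ⟨isProjective C, ‹_›, fun Q (_ : Projective Q) ↦ ?_, fun Q (_ : Projective Q) ↦ ?_⟩
  · exact (isResolving_extLeftOrthogonal _).of_projective Q
  · exact ⟨Q ⊞ Q, Q, inferInstance, ‹_›, .biprod Q Q⟩

lemma gorensteinProjective_of_isExtension (h : IsExtension X Y Z) (hY : Projective Y)
    (hX : extLeftOrthogonal (isProjective C) X) (hZ : gorensteinProjective C Z) :
    gorensteinProjective C X := by
  refine ⟨fun T ↦ T = X ∨ gorensteinProjective C T, .inl rfl, ?_, ?_⟩
  · rintro T (rfl | hT)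
    exacts [hX, gorensteinProjective_le C T hT]
  · rintro T (rfl | hT)
    · exact ⟨Y, Z, hY, .inr hZ, h⟩
    · obtain ⟨P, T', hP, hT', hTP⟩ := hasProjectiveCogenerator_gorensteinProjective C T hT
      exact ⟨P, T', hP, .inr hT', hTP⟩

lemma IsExtension.exists_projective_of_gorensteinProjective (h : IsExtension X Y Z)
    (hX : gorensteinProjective C X) (hZ : gorensteinProjective C Z) :
    ∃ P X' Y' Z', Projective P ∧ gorensteinProjective C X' ∧ gorensteinProjective C Z' ∧
      IsExtension X' Y' Z' ∧ IsExtension Y P Y' := by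
  obtain ⟨P, X', hP, hX', hXP⟩ := hasProjectiveCogenerator_gorensteinProjective C X hX
  obtain ⟨Q, Z', hQ, hZ', hZQ⟩ := hasProjectiveCogenerator_gorensteinProjective C Z hZ
  obtain ⟨L, hYL, hPL⟩ := h.exists_pushout hXP
  have := gorensteinProjective_le C Z hZ hP 0
  obtain ⟨e⟩ := hPL.nonempty_iso_biprod
  obtain ⟨Y', hY', hXY'⟩ :=
    (hYL.of_iso (.refl Y) e (.refl X')).exists_cokernel_comp (hZQ.biprod_left P)
  exact ⟨P ⊞ Q, X', Y', Z', inferInstance, hX', hZ', hXY', hY'⟩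

lemma gorensteinProjective_middle (h : IsExtension X Y Z) (hX : gorensteinProjective C X)
    (hZ : gorensteinProjective C Z) : gorensteinProjective C Y := by
  refine ⟨fun T ↦ ∃ U V, gorensteinProjective C U ∧ gorensteinProjective C V ∧ IsExtension U T V,
    ⟨X, Z, hX, hZ, h⟩, ?_, ?_⟩
  · rintro T ⟨U, V, hU, hV, hT⟩
    exact (isResolving_extLeftOrthogonal _).middle hT (gorensteinProjective_le C U hU)
      (gorensteinProjective_le C V hV)
  · rintro T ⟨U, V, hU, hV, hT⟩
    obtain ⟨P, U', T', V', hP, hU', hV', hT', hTP⟩ :=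
      hT.exists_projective_of_gorensteinProjective hU hV
    exact ⟨P, T', hP, ⟨U', V', hU', hV', hT'⟩, hTP⟩

lemma gorensteinProjective_left (h : IsExtension X Y Z) (hY : gorensteinProjective C Y)
    (hZ : gorensteinProjective C Z) : gorensteinProjective C X := by
  obtain ⟨P, Y', hP, hY', hYP⟩ := hasProjectiveCogenerator_gorensteinProjective C Y hY
  obtain ⟨L, hXL, hZL⟩ := h.exists_cokernel_comp hYP
  exact gorensteinProjective_of_isExtension hXL hP
    ((isResolving_extLeftOrthogonal _).left h (gorensteinProjective_le C Y hY)
      (gorensteinProjective_le C Z hZ)) (gorensteinProjective_middle hZL hZ hY')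

variable (C) in
lemma isResolving_gorensteinProjective : IsResolving (gorensteinProjective C) where
  of_projective := gorensteinProjective_of_projective
  middle := gorensteinProjective_middle
  left := gorensteinProjective_left

lemma gorensteinProjective_of_biprod (h : gorensteinProjective C (X ⊞ Y)) :
    gorensteinProjective C X := by
  have hG := isResolving_gorensteinProjective C
  refine ⟨fun T ↦ ∃ U, gorensteinProjective C (T ⊞ U), ⟨Y, h⟩, ?_, ?_⟩
  · rintro T ⟨U, hTU⟩
    exact extLeftOrthogonal_of_retract ⟨biprod.inl, biprod.fst, biprod.inl_fst⟩
      (gorensteinProjective_le C _ hTU)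
  · rintro T ⟨U, hTU⟩
    obtain ⟨P, V, hP, hV, h⟩ := hasProjectiveCogenerator_gorensteinProjective C _ hTU
    -- `D` is an extension of `V` by `U`, hence `T ⊞ D` is one of `V` by `T ⊞ U`
    obtain ⟨D, hD, hUD⟩ := (IsExtension.biprod T U).exists_cokernel_comp h
    exact ⟨P, D, hP, ⟨T, hG.of_iso (biprod.braiding T D)
      (hG.middle (hUD.biprod_left T) hTU hV)⟩, hD⟩

end GorensteinProjective

section IntChain

lemma exists_int_chain {α : Type*} {r : α → α → Prop} {p q : α → Prop}
    (hp : ∀ a, p a → ∃ b, p b ∧ r a b) (hq : ∀ a, q a → ∃ b, q b ∧ r b a) {a : α}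
    (hpa : p a) (hqa : q a) :
    ∃ x : ℤ → α, x 0 = a ∧ (∀ i, r (x i) (x (i + 1))) ∧ ∀ i, p (x i) ∨ q (x i) := by
  choose! s hs using hp
  choose! t ht using hq
  have hps (n : ℕ) : p (s^[n] a) := Function.Iterate.rec p hpa (fun b hb ↦ (hs b hb).1) n
  have hqt (n : ℕ) : q (t^[n] a) := Function.Iterate.rec q hqa (fun b hb ↦ (ht b hb).1) n
  let x : ℤ → α
    | Int.ofNat n => s^[n] a
    | Int.negSucc n => t^[n + 1] a
  refine ⟨x, rfl, ?_, ?_⟩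
  · rintro (n | _ | n)
    · change r (s^[n] a) (s^[n + 1] a)
      rw [Function.iterate_succ_apply']
      exact (hs _ (hps n)).2
    · exact (ht _ hqa).2
    · change r (t^[n + 2] a) (t^[n + 1] a)
      rw [Function.iterate_succ_apply' t (n + 1)]
      exact (ht _ (hqt (n + 1))).2
  · rintro (n | n)
    · exact .inl (hps n)
    · exact .inr (hqt (n + 1))

lemma exists_int_chain_of_gorensteinProjective {C : Type u₁} [Category.{v} C] [Abelian C]
    [HasExt.{w} C] [EnoughProjectives C] {X : C} (hX : gorensteinProjective C X) :
    ∃ Z : ℤ → C, Z 0 = X ∧ (∀ i, ∃ P, Projective P ∧ IsExtension (Z i) P (Z (i + 1))) ∧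
      ∀ i, extLeftOrthogonal (isProjective C) (Z i) := by
  have horth := isResolving_extLeftOrthogonal (isProjective C)
  have hright (Y : C) (hY : gorensteinProjective C Y) :
      ∃ Z, gorensteinProjective C Z ∧ ∃ P, Projective P ∧ IsExtension Y P Z := by
    obtain ⟨P, Z, hP, hZ, h⟩ := hasProjectiveCogenerator_gorensteinProjective C Y hY
    exact ⟨Z, hZ, P, hP, h⟩
  have hleft (Y : C) (hY : extLeftOrthogonal (isProjective C) Y) :
      ∃ Z, extLeftOrthogonal (isProjective C) Z ∧ ∃ P, Projective P ∧ IsExtension Z P Y :=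
    have h := IsExtension.kernel (Projective.π Y)
    ⟨_, horth.left h (horth.of_projective _) hY, _, inferInstance, h⟩
  obtain ⟨Z, hZ, hext, hmem⟩ :=
    exists_int_chain hright hleft hX (gorensteinProjective_le C X hX)
  exact ⟨Z, hZ, hext, fun i ↦ (hmem i).elim (gorensteinProjective_le C _) id⟩

end IntChain

section Complexes

variable {C : Type u₁} [Category.{v} C] [Abelian C]

section Cycles

variable {ι : Type*} {c : ComplexShape ι} (K : HomologicalComplex C c)

lemma iCycles_toCycles (i j : ι) : K.iCycles i ≫ K.toCycles i j = 0 := by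
  rw [← cancel_mono (K.iCycles j), Category.assoc, K.toCycles_i, K.iCycles_d, zero_comp]

lemma epi_toCycles {i j : ι} (hij : c.Rel i j) (hK : K.ExactAt j) : Epi (K.toCycles i j) := by
  obtain rfl := c.prev_eq' hij
  have h : Epi (K.sc j).toCycles := (K.sc j).exact_iff_epi_toCycles.1 hK
  have : K.toCycles (c.prev j) j = (K.sc j).toCycles :=
    (cancel_mono (K.iCycles j)).1 ((K.toCycles_i _ _).trans (K.sc j).toCycles_i.symm)
  rwa [this]

lemma shortExact_cycles {i j : ι} (hij : c.Rel i j) (hK : K.ExactAt j) :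
    (ShortComplex.mk (K.iCycles i) (K.toCycles i j) (iCycles_toCycles K i j)).ShortExact where
  exact := by
    have hd : K.toCycles i j ≫ K.iCycles j = K.d i j := K.toCycles_i i j
    refine ShortComplex.exact_of_f_is_kernel _ (isKernelOfComp (K.iCycles j) (K.d i j)
      (K.cyclesIsKernel i j (c.next_eq' hij)) (iCycles_toCycles K i j) hd)
  epi_g := epi_toCycles K hij hK

end Cycles

lemma exact_epi_comp_comp_mono {S : ShortComplex C} (hS : S.Exact) {X Y : C} (e : X ⟶ S.X₁)
    [Epi e] (m : S.X₃ ⟶ Y) [Mono m] :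
    (ShortComplex.mk (e ≫ S.f) (S.g ≫ m) (by simp)).Exact := by
  let T := ShortComplex.mk (e ≫ S.f) S.g (by simp)
  let φ : T ⟶ S := { τ₁ := e, τ₂ := 𝟙 _, τ₃ := 𝟙 _ }
  let ψ : T ⟶ ShortComplex.mk (e ≫ S.f) (S.g ≫ m) (by simp) := { τ₁ := 𝟙 _, τ₂ := 𝟙 _, τ₃ := m }
  have : Epi φ.τ₁ := ‹Epi e›
  have : IsIso φ.τ₂ := inferInstanceAs (IsIso (𝟙 _))
  have : Mono φ.τ₃ := inferInstanceAs (Mono (𝟙 _))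
  have : Epi ψ.τ₁ := inferInstanceAs (Epi (𝟙 _))
  have : IsIso ψ.τ₂ := inferInstanceAs (IsIso (𝟙 _))
  have : Mono ψ.τ₃ := ‹Mono m›
  exact (ShortComplex.exact_iff_of_epi_of_isIso_of_mono ψ).1
    ((ShortComplex.exact_iff_of_epi_of_isIso_of_mono φ).2 hS)

section Splice

variable {X P : ℤ → C} (f : ∀ i, X i ⟶ P i) (g : ∀ i, P i ⟶ X (i + 1)) (w : ∀ i, f i ≫ g i = 0)

/-- The complex `⋯ ⟶ P i ⟶ P (i + 1) ⟶ ⋯` spliced from sequences `X i ⟶ P i ⟶ X (i + 1)`. -/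
def spliceComplex : CochainComplex C ℤ :=
  CochainComplex.of P (fun i ↦ g i ≫ f (i + 1)) fun i ↦ by
    rw [Category.assoc, reassoc_of% w (i + 1), zero_comp, comp_zero]

lemma spliceComplex_d (i : ℤ) : (spliceComplex f g w).d i (i + 1) = g i ≫ f (i + 1) :=
  CochainComplex.of_d P (fun i ↦ g i ≫ f (i + 1)) i

variable {f g w} (hS : ∀ i, (ShortComplex.mk (f i) (g i) (w i)).ShortExact)

include hS

lemma spliceComplex_acyclic : (spliceComplex f g w).Acyclic := by
  intro i
  obtain ⟨i, rfl⟩ : ∃ j, i = j + 1 := ⟨i - 1, by ring⟩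
  have := (hS i).epi_g
  have := (hS (i + 1 + 1)).mono_f
  rw [HomologicalComplex.exactAt_iff' _ i (i + 1) (i + 1 + 1) (ComplexShape.prev_eq' _ rfl)
    (CochainComplex.next ..)]
  convert exact_epi_comp_comp_mono (hS (i + 1)).exact (g i) (f (i + 1 + 1)) using 1
  simp only [HomologicalComplex.sc', HomologicalComplex.shortComplexFunctor']
  congr 1 <;> exact spliceComplex_d f g w _

lemma nonempty_iso_cycles_spliceComplex (i : ℤ) :
    Nonempty (X i ≅ (spliceComplex f g w).cycles i) := by
  have := (hS (i + 1)).mono_f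
  have hK := (spliceComplex f g w).cyclesIsKernel i (i + 1) (CochainComplex.next ..)
  exact ⟨(isKernelCompMono (hS i).fIsKernel (f (i + 1)) (spliceComplex_d f g w i)
    ).conePointUniqueUpToIso hK⟩

end Splice

end Complexes

section TotallyAcyclic

variable {A : Type u} [Ring A]

section HomComplexes

variable {ι : Type} {c : ComplexShape ι} (K : HomologicalComplex (ModuleCat.{u} A) c)
  {i j k : ι}

lemma homInto_exactAt_iff (Q : ModuleCat.{u} A) (hij : c.prev j = i) (hjk : c.next j = k) :
    (homInto K Q).ExactAt j ↔
      ∀ f : K.X j ⟶ Q, K.d i j ≫ f = 0 → ∃ g : K.X k ⟶ Q, K.d j k ≫ g = f := by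
  rw [HomologicalComplex.exactAt_iff' (homInto K Q) k j i hjk hij, ShortComplex.ab_exact_iff]
  rfl

lemma homFrom_exactAt_iff (G : ModuleCat.{u} A) (hij : c.prev j = i) (hjk : c.next j = k) :
    (homFrom G K).ExactAt j ↔
      ∀ f : G ⟶ K.X j, f ≫ K.d j k = 0 → ∃ g : G ⟶ K.X i, g ≫ K.d i j = f := by
  rw [HomologicalComplex.exactAt_iff' (homFrom G K) i j k hij hjk, ShortComplex.ab_exact_iff]
  rfl

end HomComplexes

lemma isTotallyAcyclic_spliceComplex {X P : ℤ → ModuleCat.{u} A} {f : ∀ i, X i ⟶ P i}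
    {g : ∀ i, P i ⟶ X (i + 1)} {w : ∀ i, f i ≫ g i = 0}
    (hS : ∀ i, (ShortComplex.mk (f i) (g i) (w i)).ShortExact) (hP : ∀ i, Projective (P i))
    (hX : ∀ i Q, Projective Q → Subsingleton (Ext (X i) Q 1)) :
    IsTotallyAcyclic (spliceComplex f g w) where
  projective i := (IsProjective.iff_projective (P i)).2 (hP i)
  acyclic := spliceComplex_acyclic hS
  hom_acyclic Q hQ i := by
    obtain ⟨i, rfl⟩ : ∃ j, i = j + 1 := ⟨i - 1, by ring⟩
    have := (hS i).epi_g
    have := (hS (i + 1)).epi_g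
    rw [homInto_exactAt_iff _ Q (ComplexShape.prev_eq' _ rfl) (CochainComplex.next ..)]
    intro φ hφ
    rw [spliceComplex_d] at hφ
    obtain ⟨ψ, rfl⟩ := (hS (i + 1)).exact.desc' φ
      (zero_of_epi_comp (g i) ((Category.assoc _ _ _).symm.trans hφ))
    have := hX (i + 1 + 1 + 1) Q ((IsProjective.iff_projective Q).1 hQ)
    obtain ⟨θ, rfl⟩ := exists_extension_of_subsingleton_ext (hS (i + 1 + 1)) ψ
    exact ⟨θ, by rw [spliceComplex_d]; exact Category.assoc _ _ _⟩

namespace IsTotallyAcyclic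

variable {P : CochainComplex (ModuleCat.{u} A) ℤ} (hP : IsTotallyAcyclic P)

include hP

lemma isExtension_cycles (i : ℤ) : IsExtension (P.cycles i) (P.X i) (P.cycles (i + 1)) :=
  .of_shortExact (shortExact_cycles P (i := i) (j := i + 1) rfl (hP.acyclic _))

lemma projective_X (i : ℤ) : Projective (P.X i) :=
  (IsProjective.iff_projective _).1 (hP.projective i)

lemma subsingleton_ext_one_cycles (i : ℤ) (Q : ModuleCat.{u} A) (hQ : Projective Q) :
    Subsingleton (Ext (P.cycles i) Q 1) := by
  obtain ⟨i, rfl⟩ : ∃ j, i = j + 1 + 1 + 1 := ⟨i - 1 - 1 - 1, by ring⟩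
  have hS := shortExact_cycles P (i := i + 1 + 1) (j := i + 1 + 1 + 1) rfl (hP.acyclic _)
  have := epi_toCycles P (i := i + 1) (j := i + 1 + 1) rfl (hP.acyclic _)
  have := hP.projective_X (i + 1 + 1)
  have : Subsingleton (Ext (P.X (i + 1 + 1)) Q 1) := Ext.subsingleton_of_projective _ Q 0
  refine subsingleton_ext_one_of_forall_exists_extension hS fun φ ↦ ?_
  obtain ⟨ψ, hψ⟩ := (homInto_exactAt_iff P Q (ComplexShape.prev_eq' _ rfl)
    (CochainComplex.next ..)).1 (hP.hom_acyclic Q ((IsProjective.iff_projective Q).2 hQ) _)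
    (P.toCycles (i + 1) (i + 1 + 1) ≫ φ) (by rw [← Category.assoc, P.d_toCycles, zero_comp])
  refine ⟨ψ, ?_⟩
  rw [← cancel_epi (P.toCycles (i + 1) (i + 1 + 1)), ← hψ, ← Category.assoc, P.toCycles_i]

lemma gorensteinProjective_cycles (i : ℤ) :
    gorensteinProjective (ModuleCat.{u} A) (P.cycles i) := by
  refine ⟨fun X ↦ ∃ i, X = P.cycles i, ⟨i, rfl⟩, ?_, ?_⟩
  · rintro _ ⟨i, rfl⟩
    exact extLeftOrthogonal_of_int_chain (Q := isProjective _) (fun i ↦ P.cycles i)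
      (fun i ↦ ⟨P.X i, hP.projective_X i, hP.isExtension_cycles i⟩)
      (fun i Q hQ ↦ hP.subsingleton_ext_one_cycles i Q hQ) i
  · rintro _ ⟨i, rfl⟩
    exact ⟨P.X i, _, hP.projective_X i, ⟨i + 1, rfl⟩, hP.isExtension_cycles i⟩

end IsTotallyAcyclic

lemma isGorensteinProjective_iff (M : ModuleCat.{u} A) :
    IsGorensteinProjective M ↔ gorensteinProjective (ModuleCat.{u} A) M := by
  constructor
  · rintro ⟨P, hP, ⟨e⟩⟩
    exact (isResolving_gorensteinProjective _).of_iso e.symm (hP.gorensteinProjective_cycles 0)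
  · intro hM
    obtain ⟨X, rfl, hX, horth⟩ := exists_int_chain_of_gorensteinProjective hM
    choose P hP h using hX
    choose f g w hS using h
    exact ⟨spliceComplex f g w, isTotallyAcyclic_spliceComplex hS hP fun i Q hQ ↦ horth i hQ 0,
      nonempty_iso_cycles_spliceComplex hS 0⟩

end TotallyAcyclic

section ChainComplex

lemma chainComplex_exactAt_zero_iff {C : Type u₁} [Category.{v} C] [Abelian C]
    (K : ChainComplex C ℕ) : K.ExactAt 0 ↔ Epi (K.d 1 0) := by
  rw [K.exactAt_iff' 1 0 0 (by simp) (by simp),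
    ShortComplex.exact_iff_epi _ (K.shape 0 0 (by simp))]
  rfl

lemma chainComplex_exactAt_succ_iff {C : Type u₁} [Category.{v} C] [Abelian C]
    (K : ChainComplex C ℕ) (i : ℕ) : K.ExactAt (i + 1) ↔
      (ShortComplex.mk (K.d (i + 2) (i + 1)) (K.d (i + 1) i) (K.d_comp_d _ _ _)).Exact :=
  K.exactAt_iff' (i + 2) (i + 1) i (by simp) (by simp)

variable {A : Type u} [Ring A] (K : ChainComplex (ModuleCat.{u} A) ℕ) (G : ModuleCat.{u} A)

lemma homFrom_exactAt_zero_iff :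
    (homFrom G K).ExactAt 0 ↔ ∀ φ : G ⟶ K.X 0, ∃ ψ : G ⟶ K.X 1, ψ ≫ K.d 1 0 = φ := by
  rw [homFrom_exactAt_iff (i := 1) (k := 0) K G (by simp) (by simp)]
  simp only [K.shape 0 0 (by simp), comp_zero, forall_const]

lemma homFrom_exactAt_succ_iff (i : ℕ) :
    (homFrom G K).ExactAt (i + 1) ↔ ∀ φ : G ⟶ K.X (i + 1), φ ≫ K.d (i + 1) i = 0 →
      ∃ ψ : G ⟶ K.X (i + 2), ψ ≫ K.d (i + 2) (i + 1) = φ :=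
  homFrom_exactAt_iff (i := i + 2) (k := i) K G (by simp) (by simp)

end ChainComplex

namespace LeftResolution

variable {A : Type u} [Ring A] {K G M : ModuleCat.{u} A}

/-- The zero complex as a resolution of a zero module. -/
def zero (hM : IsZero M) : LeftResolution M where
  complex := 0
  ε := 0
  w := comp_zero
  acyclic i := ShortComplex.exact_of_isZero_X₂ _ <| by
    cases i with
    | zero => exact hM
    | succ i => exact (HomologicalComplex.eval _ _ i).map_isZero (isZero_zero _)

lemma isZero_zero_X (hM : IsZero M) (i : ℕ) : IsZero ((zero hM).complex.X i) :=
  (HomologicalComplex.eval _ _ i).map_isZero (isZero_zero _)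

lemma isProperGP_zero (hM : IsZero M) : (zero hM).IsProperGP where
  gorensteinProjective i := by
    have := (isZero_zero_X hM i).projective
    exact (isGorensteinProjective_iff _).2 (gorensteinProjective_of_projective _)
  hom_acyclic H _ i := by
    refine ShortComplex.exact_of_isZero_X₂ _ ?_
    refine (preadditiveCoyoneda.obj (op H)).map_isZero ?_
    cases i with
    | zero => exact hM
    | succ i => exact isZero_zero_X hM i

section Splice

variable {f : K ⟶ G} {g : G ⟶ M} {w : f ≫ g = 0}

/-- The resolution `⋯ ⟶ X 1 ⟶ X 0 ⟶ G ⟶ M ⟶ 0` spliced from a resolution of `K` and a short exact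
sequence `0 ⟶ K ⟶ G ⟶ M ⟶ 0`. -/
def splice (E : LeftResolution K) (hS : (ShortComplex.mk f g w).ShortExact) :
    LeftResolution M where
  complex := E.complex.augment (E.ε ≫ f) (by rw [reassoc_of% E.w, zero_comp])
  ε := g
  w := show (E.ε ≫ f) ≫ g = 0 by rw [Category.assoc, w, comp_zero]
  acyclic i := by
    have : Epi E.ε := (chainComplex_exactAt_zero_iff _).1 (E.acyclic 0)
    have : Mono f := hS.mono_f
    match i with
    | 0 => exact (chainComplex_exactAt_zero_iff _).2 hS.epi_g
    | 1 =>
      have h := exact_epi_comp_comp_mono hS.exact E.ε (𝟙 M)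
      simp only [Category.comp_id] at h
      exact (chainComplex_exactAt_succ_iff _ 0).2 h
    | 2 =>
      have h := exact_epi_comp_comp_mono (S := .mk _ _ E.w)
        ((chainComplex_exactAt_succ_iff _ 0).1 (E.acyclic 1)) (𝟙 _) f
      simp only [Category.id_comp] at h
      exact (chainComplex_exactAt_succ_iff _ 1).2 h
    | i + 3 =>
      have h := (chainComplex_exactAt_succ_iff _ (i + 1)).1 (E.acyclic (i + 2))
      exact (chainComplex_exactAt_succ_iff _ (i + 2)).2 h

lemma IsProperGP.splice {E : LeftResolution K} (hE : E.IsProperGP)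
    (hS : (ShortComplex.mk f g w).ShortExact) (hG : GorensteinProj.gorensteinProjective _ G)
    (hK : ∀ H, GorensteinProj.gorensteinProjective _ H → Subsingleton (Ext H K 1)) :
    (E.splice hS).IsProperGP where
  gorensteinProjective
    | 0 => (isGorensteinProjective_iff G).2 hG
    | i + 1 => hE.gorensteinProjective i
  hom_acyclic H hH i := by
    have : Mono f := hS.mono_f
    have hE' := hE.hom_acyclic H hH
    match i with
    | 0 =>
      have := hK H ((isGorensteinProjective_iff H).1 hH)
      exact (homFrom_exactAt_zero_iff ..).2 fun φ ↦ exists_lift_of_subsingleton_ext hS φ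
    | 1 =>
      refine (homFrom_exactAt_succ_iff ..).2 fun φ hφ ↦ ?_
      obtain ⟨ψ, rfl⟩ := hS.exact.lift' φ hφ
      obtain ⟨θ, rfl⟩ := (homFrom_exactAt_zero_iff ..).1 (hE' 0) ψ
      exact ⟨θ, (Category.assoc _ _ _).symm⟩
    | 2 =>
      have hf (θ : H ⟶ K) (hθ : θ ≫ f = 0) : θ = 0 := zero_of_comp_mono f hθ
      exact (homFrom_exactAt_succ_iff ..).2 fun φ hφ ↦
        (homFrom_exactAt_succ_iff ..).1 (hE' 1) φ (hf _ ((Category.assoc _ _ _).trans hφ))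
    | i + 3 =>
      exact (homFrom_exactAt_succ_iff _ H (i + 2)).2
        ((homFrom_exactAt_succ_iff _ H (i + 1)).1 (hE' (i + 2)))

end Splice

section Existence

lemma exists_isProperGP_of_isExtension (hK : ∃ E : LeftResolution K, E.IsProperGP)
    (h : IsExtension K G M) (hG : gorensteinProjective _ G)
    (hKext : ∀ H, gorensteinProjective _ H → Subsingleton (Ext H K 1)) :
    ∃ E : LeftResolution M, E.IsProperGP := by
  obtain ⟨E, hE⟩ := hK
  obtain ⟨f, g, w, hS⟩ := h
  exact ⟨E.splice hS, hE.splice hS hG hKext⟩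

lemma exists_isProperGP_of_gorensteinProjective (hM : gorensteinProjective _ M) :
    ∃ E : LeftResolution M, E.IsProperGP :=
  exists_isProperGP_of_isExtension ⟨_, isProperGP_zero (isZero_zero _)⟩
    ((IsExtension.biprod 0 M).of_iso (.refl _) (isoZeroBiprod (isZero_zero _)).symm (.refl M)) hM
    fun H hH ↦ gorensteinProjective_le _ H hH (inferInstanceAs (Projective (0 : ModuleCat A))) 0

lemma exists_isProperGP_of_hasProjectiveDimensionLE (M : ModuleCat.{u} A) (d : ℕ)
    [HasProjectiveDimensionLE M d] : ∃ E : LeftResolution M, E.IsProperGP := by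
  induction d generalizing M with
  | zero =>
    have := (projective_iff_hasProjectiveDimensionLE_zero M).2 ‹_›
    exact exists_isProperGP_of_gorensteinProjective (gorensteinProjective_of_projective M)
  | succ d ih =>
    let S := ShortComplex.mk _ (Projective.π M) (kernel.condition _)
    have hS : S.ShortExact := { exact := ShortComplex.exact_of_f_is_kernel _ (kernelIsKernel _) }
    have : HasProjectiveDimensionLE S.X₁ d :=
      (hS.hasProjectiveDimensionLT_X₃_iff d (Projective.projective_over M)).1 ‹_›
    exact exists_isProperGP_of_isExtension (ih S.X₁) (.of_shortExact hS)
      (gorensteinProjective_of_projective (Projective.over M)) fun H hH ↦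
        subsingleton_ext_of_hasProjectiveDimensionLE (gorensteinProjective_le _ H hH) d S.X₁ 0

lemma exists_isProperGP_of_resolutionLE {n : ℕ}
    (hM : resolutionLE (gorensteinProjective (ModuleCat.{u} A)) n M) :
    ∃ E : LeftResolution M, E.IsProperGP := by
  cases n with
  | zero => exact exists_isProperGP_of_gorensteinProjective hM
  | succ n =>
    obtain ⟨W, X, hW, hX, h⟩ := exists_approximation_of_resolutionLE_succ
      (isResolving_gorensteinProjective _) (hasProjectiveCogenerator_gorensteinProjective _) hM
    exact exists_isProperGP_of_isExtension (exists_isProperGP_of_hasProjectiveDimensionLE W n) h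
      hX fun H hH ↦
        subsingleton_ext_of_hasProjectiveDimensionLE (gorensteinProjective_le _ H hH) n W 0

lemma exists_projective_truncation (M : ModuleCat.{u} A) (n : ℕ) :
    ∃ E : LeftResolution M, (∀ i < n, Projective (E.complex.X i)) ∧
      ∀ i > n, IsZero (E.complex.X i) := by
  induction n generalizing M with
  | zero =>
    obtain ⟨f, g, w, hS⟩ := (IsExtension.biprod 0 M).of_iso (.refl _)
      (isoZeroBiprod (isZero_zero _)).symm (.refl M)
    refine ⟨(zero (isZero_zero _)).splice hS, fun i hi ↦ absurd hi i.not_lt_zero, fun i hi ↦ ?_⟩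
    obtain ⟨i, rfl⟩ := Nat.exists_eq_succ_of_ne_zero hi.ne'
    exact isZero_zero_X (isZero_zero _) i
  | succ n ih =>
    obtain ⟨f, g, w, hS⟩ := IsExtension.kernel (Projective.π M)
    obtain ⟨E, hE, hE'⟩ := ih (kernel (Projective.π M))
    refine ⟨E.splice hS, ?_, ?_⟩
    · rintro (_ | i) hi
      exacts [Projective.projective_over M, hE i (by lia)]
    · rintro (_ | i) hi
      exacts [absurd hi (by lia), hE' i (by lia)]

end Existence

section Syzygies

variable (E : LeftResolution M)

lemma shortExact_cycles (i : ℕ) :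
    (ShortComplex.mk (E.augmented.iCycles (i + 1)) (E.augmented.toCycles (i + 1) i)
      (iCycles_toCycles _ _ _)).ShortExact :=
  GorensteinProj.shortExact_cycles E.augmented (i := i + 1) (j := i) rfl (E.acyclic i)

lemma isExtension_cycles (i : ℕ) :
    IsExtension (E.augmented.cycles (i + 1)) (E.complex.X i) (E.augmented.cycles i) :=
  .of_shortExact (E.shortExact_cycles i)

lemma nonempty_cycles_zero_iso : Nonempty (E.augmented.cycles 0 ≅ M) := by
  have := E.augmented.isIso_iCycles 0 0 (by simp) (E.augmented.shape _ _ (by simp))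
  let e := asIso (E.augmented.iCycles 0)
  exact ⟨e⟩

lemma nonempty_X_iso_cycles {n : ℕ} (hX : IsZero (E.complex.X (n + 1))) :
    Nonempty (E.complex.X n ≅ E.augmented.cycles n) := by
  have := (E.shortExact_cycles (n + 1)).epi_g
  have h : IsZero (E.augmented.cycles (n + 1)) := hX.of_epi (E.augmented.toCycles (n + 2) (n + 1))
  have : IsIso (E.augmented.toCycles (n + 1) n) := (E.shortExact_cycles n).isIso_g_iff.2 h
  let e := asIso (E.augmented.toCycles (n + 1) n)
  exact ⟨e⟩

lemma resolutionLE_iff_gorensteinProjective_cycles {n : ℕ}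
    (hX : ∀ i < n, gorensteinProjective _ (E.complex.X i)) :
    resolutionLE (gorensteinProjective _) n M ↔
      gorensteinProjective _ (E.augmented.cycles n) := by
  have hG := isResolving_gorensteinProjective (ModuleCat.{u} A)
  obtain ⟨e⟩ := E.nonempty_cycles_zero_iso
  rw [← hG.resolutionLE_iff_of_chain n (fun i ↦ E.augmented.cycles i) _
    (fun i _ ↦ E.isExtension_cycles i) hX]
  exact ⟨hG.resolutionLE_of_iso e.symm, hG.resolutionLE_of_iso e⟩

lemma isZero_gpExt_succ_iff (N : ModuleCat.{u} A) (n : ℕ) :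
    IsZero (gpExt E N (n + 1)) ↔
      ∀ φ : E.augmented.X (n + 2) ⟶ N, E.augmented.d (n + 3) (n + 2) ≫ φ = 0 →
        ∃ ψ : E.augmented.X (n + 1) ⟶ N, E.augmented.d (n + 2) (n + 1) ≫ ψ = φ :=
  (HomologicalComplex.exactAt_iff_isZero_homology _ _).symm.trans
    (homInto_exactAt_iff (i := n + 2) (k := n) E.complex N (by simp) (by simp))

lemma forall_isZero_gpExt_succ_iff_isSplitMono (n : ℕ) :
    (∀ N, IsZero (gpExt E N (n + 1))) ↔ IsSplitMono (E.augmented.iCycles (n + 1)) := by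
  simp only [isZero_gpExt_succ_iff]
  have := (E.shortExact_cycles (n + 1)).epi_g
  have := (E.shortExact_cycles (n + 2)).epi_g
  constructor
  · intro h
    obtain ⟨r, hr⟩ := h (E.augmented.cycles (n + 1)) (E.augmented.toCycles (n + 2) (n + 1))
      (E.augmented.d_toCycles _ _ _)
    refine .mk' ⟨r, ?_⟩
    rw [← cancel_epi (E.augmented.toCycles (n + 2) (n + 1)), ← Category.assoc,
      E.augmented.toCycles_i, hr, Category.comp_id]
  · intro _ N φ hφ
    obtain ⟨ψ, rfl⟩ := (E.shortExact_cycles (n + 1)).exact.desc' φ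
      (by rwa [← cancel_epi (E.augmented.toCycles (n + 3) (n + 2)), ← Category.assoc,
        E.augmented.toCycles_i, comp_zero])
    refine ⟨retraction (E.augmented.iCycles (n + 1)) ≫ ψ, ?_⟩
    rw [← E.augmented.toCycles_i, Category.assoc, IsSplitMono.id_assoc]

namespace IsProperGP

variable {E} (hE : E.IsProperGP)

include hE

lemma gorensteinProjective_X (i : ℕ) : GorensteinProj.gorensteinProjective _ (E.complex.X i) :=
  (isGorensteinProjective_iff _).1 (hE.gorensteinProjective i)

lemma gorensteinProjective_cycles_iff_isSplitMono (n : ℕ) :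
    GorensteinProj.gorensteinProjective _ (E.augmented.cycles n) ↔
      IsSplitMono (E.augmented.iCycles (n + 1)) := by
  have hS := E.shortExact_cycles n
  constructor
  · intro h
    obtain ⟨s, hs⟩ := (homFrom_exactAt_iff (i := n + 1) _ _ (by simp) rfl).1
      (hE.hom_acyclic _ ((isGorensteinProjective_iff _).2 h) n) (E.augmented.iCycles n)
      (E.augmented.iCycles_d _ _)
    have hs' : s ≫ E.augmented.toCycles (n + 1) n = 𝟙 _ := by
      rw [← cancel_mono (E.augmented.iCycles n), Category.assoc, E.augmented.toCycles_i, hs,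
        Category.id_comp]
    have σ := ShortComplex.Splitting.ofExactOfSection _ hS.exact s hs' hS.mono_f
    exact .mk' ⟨σ.r, σ.f_r⟩
  · intro _
    obtain ⟨e⟩ := nonempty_iso_biprod_of_isSplitMono hS
    exact gorensteinProjective_of_biprod ((isResolving_gorensteinProjective _).of_iso
      (e ≪≫ biprod.braiding _ _) (hE.gorensteinProjective_X n))

lemma gorensteinProjective_cycles_of_le {n m : ℕ} (hnm : n ≤ m)
    (hn : GorensteinProj.gorensteinProjective _ (E.augmented.cycles n)) :
    GorensteinProj.gorensteinProjective _ (E.augmented.cycles m) :=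
  Nat.le_induction hn (fun m _ hm ↦ gorensteinProjective_left (E.isExtension_cycles m)
    (hE.gorensteinProjective_X m) hm) m hnm

lemma resolutionLE_iff_forall_isZero_gpExt (n : ℕ) :
    resolutionLE (GorensteinProj.gorensteinProjective _) n M ↔
      ∀ m > n, ∀ N, IsZero (gpExt E N m) := by
  have hiff (m : ℕ) : GorensteinProj.gorensteinProjective _ (E.augmented.cycles m) ↔
      ∀ N, IsZero (gpExt E N (m + 1)) :=
    (hE.gorensteinProjective_cycles_iff_isSplitMono m).trans
      (E.forall_isZero_gpExt_succ_iff_isSplitMono m).symm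
  rw [E.resolutionLE_iff_gorensteinProjective_cycles fun i _ ↦ hE.gorensteinProjective_X i]
  refine ⟨fun h m hm ↦ ?_, fun h ↦ (hiff n).2 (h (n + 1) n.lt_succ_self)⟩
  obtain ⟨m, rfl⟩ := Nat.exists_eq_succ_of_ne_zero (Nat.ne_zero_of_lt hm)
  exact (hiff m).1 (hE.gorensteinProjective_cycles_of_le (Nat.le_of_lt_succ hm) h)

end IsProperGP

end Syzygies

end LeftResolution

lemma gpDim_le_iff_resolutionLE {A : Type u} [Ring A] (M : ModuleCat.{u} A) (n : ℕ) :
    gpDim M ≤ n ↔ resolutionLE (gorensteinProjective _) n M := by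
  by_cases h : ∃ E : LeftResolution M, E.IsProperGP
  · rw [gpDim, dif_pos h, h.choose_spec.resolutionLE_iff_forall_isZero_gpExt n, sSup_le_iff]
    constructor
    · intro hle m hm N
      by_contra hN
      exact hm.not_ge (Nat.cast_le.1 (hle m ⟨m, rfl, N, hN⟩))
    · rintro hz _ ⟨m, rfl, N, hN⟩
      exact Nat.cast_le.2 (not_lt.1 fun hm ↦ hN (hz m hm N))
  · rw [gpDim, dif_neg h]
    exact iff_of_false (by simp)
      fun hM ↦ h (LeftResolution.exists_isProperGP_of_resolutionLE hM)

end GorensteinProj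

end

/-- Where `gpDim` takes the value `⊤` for lack of a proper resolution, the other two conditions fail
as well, since a finite Gorenstein-projective resolution yields a proper one. -/
theorem mainTheorem7_general {A : Type u} [Ring A] (M : ModuleCat.{u} A) (n : ℕ) :
    List.TFAE [
      GorensteinProj.gpDim M ≤ (n : ℕ∞),
      ∃ E : GorensteinProj.LeftResolution M,
        (∀ i ≤ n, GorensteinProj.IsGorensteinProjective (E.complex.X i)) ∧
        (∀ i > n, CategoryTheory.Limits.IsZero (E.complex.X i)),
      ∀ E : GorensteinProj.LeftResolution M,
        (∀ i < n, GorensteinProj.IsGorensteinProjective (E.complex.X i)) →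
        (∀ i > n, CategoryTheory.Limits.IsZero (E.complex.X i)) →
        GorensteinProj.IsGorensteinProjective (E.complex.X n)] := by
  have hG := GorensteinProj.isResolving_gorensteinProjective (ModuleCat.{u} A)
  simp only [GorensteinProj.gpDim_le_iff_resolutionLE,
    GorensteinProj.isGorensteinProjective_iff]
  tfae_have 1 → 3 := by
    intro h E hX hZ
    obtain ⟨e⟩ := E.nonempty_X_iso_cycles (hZ (n + 1) n.lt_succ_self)
    exact hG.of_iso e.symm ((E.resolutionLE_iff_gorensteinProjective_cycles hX).1 h)
  tfae_have 3 → 2 := by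
    intro h
    obtain ⟨E, hX, hZ⟩ := GorensteinProj.LeftResolution.exists_projective_truncation M n
    have hX' (i : ℕ) (hi : i < n) := have := hX i hi; hG.of_projective (E.complex.X i)
    exact ⟨E, fun i hi ↦ hi.lt_or_eq.elim (hX' i) fun hin ↦ hin ▸ h E hX' hZ, hZ⟩
  tfae_have 2 → 1 := by
    rintro ⟨E, hX, hZ⟩
    obtain ⟨e⟩ := E.nonempty_X_iso_cycles (hZ (n + 1) n.lt_succ_self)
    exact (E.resolutionLE_iff_gorensteinProjective_cycles fun i hi ↦ hX i hi.le).2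
      (hG.of_iso e (hX n le_rfl))
  tfae_finish

theorem mainTheorem7 (R : Type w) [CommRing R] [IsArtinianRing R]
    (A : Type u) [Ring A] [Algebra R A] [Module.Finite R A]
    (M : ModuleCat.{u} A) (n : ℕ) :
    List.TFAE [
      GorensteinProj.gpDim M ≤ (n : ℕ∞),
      -- an exact sequence `0 ⟶ X n ⟶ ⋯ ⟶ X 0 ⟶ M ⟶ 0` with Gorenstein-projective `X i`
      ∃ E : GorensteinProj.LeftResolution M,
        (∀ i ≤ n, GorensteinProj.IsGorensteinProjective (E.complex.X i)) ∧
        (∀ i > n, CategoryTheory.Limits.IsZero (E.complex.X i)),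
      -- exact sequences `0 ⟶ X n ⟶ X (n - 1) ⟶ ⋯ ⟶ X 0 ⟶ M ⟶ 0` with `X i`
      -- Gorenstein-projective for `i < n`; for `n = 0` this is `0 ⟶ X 0 ⟶ M ⟶ 0`
      ∀ E : GorensteinProj.LeftResolution M,
        (∀ i < n, GorensteinProj.IsGorensteinProjective (E.complex.X i)) →
        (∀ i > n, CategoryTheory.Limits.IsZero (E.complex.X i)) →
        GorensteinProj.IsGorensteinProjective (E.complex.X n)] :=
  mainTheorem7_general M n
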